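/- Let $M,N\ge 1$ and $d$ be integers. Node $i\in\{1,\dots,M\}$ holds samples $(x_{ij},y_{ij})\in\mathbb R^d\times\{\pm1\}$, $j=1,\dots,N$. Put $C_i=\{w\in\mathbb R^d : y_{ij}x_{ij}^Tw\ge 1,\ j=1,\dots,N\}$ and call the dataset separable if every $C_i$ and $\bar C=\bigcap_{i=1}^M C_i$ are nonempty. Let $\alpha^k=1-\frac1{k+1}$ for $k\ge 0$, and let $\|\cdot\|$ be the Euclidean norm. For $\lambda>0$, Modified Local-GD (local problems solved to convergence) produces global models $w_0^k=w_0^k(\lambda)$ by $w_0^0=0$, $$w_i^{k+1}=\arg\min_{w\in\mathbb R^d}\ \sum_{j=1}^N e^{-y_{ij}x_{ij}^Tw}+\frac\lambda2\|w-w_0^k\|^2,\qquad w_0^{k+1}=(1-\alpha^k)w_0^0+\alpha^k\,\frac1M\sum_{i=1}^M w_i^{k+1}.$$ The Modified Parallel Projection Method (PPM) produces $\bar w_0^k$ by $\bar w_0^0=0$, $$\bar w_i^{k+1}=\arg\min_{w\in C_i}\|w-\bar w_0^k\|,\qquad \bar w_0^{k+1}=(1-\alpha^k)\bar w_0^0+\alpha^k\,\frac1M\sum_{i=1}^M\bar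 w_i^{k+1}.$$ Suppose the features $(x_{ij})$ are drawn from a probability distribution on $(\mathbb R^d)^{MN}$ that is absolutely continuous with respect to Lebesgue measure. Then for almost every $(x_{ij})$ and every choice of labels $y_{ij}\in\{\pm1\}$ for which the dataset is separable, the following hold. 1. There are $C\in\mathbb R$ and $\lambda_0>0$, depending on the dataset but on neither $k$ nor $\lambda$, such that for all $0<\lambda<\lambda_0$ and all $k\ge 0$ $$\Big\|w_0^k-\ln\big(\tfrac1\lambda\big)\,\bar w_0^k\Big\|\le C\,k\,\ln\ln\tfrac1\lambda .$$ 2. For every fixed $k$, $w_0^k/\ln(1/\lambda)\to\bar w_0^k$ as $\lambda\to0^+$. 3. For every $k\ge2$ we have $\bar w_0^k\ne0$, $w_0^k\neq 0$ for all sufficiently small $\lambda>0$, and $$\lim_{\lambda\to0^+}\frac{w_0^k}{\|w_0^k\|}=\frac{\bar w_0^k}{\|\bar w_0^k\|}.$$ 4. More generally, let the round $k=k(\lambda)$ depend on $\lambda$, with $k(\lambda)\ge2$ for all sufficiently small $\lambda>0$ and $k(\lambda)=o\!\left(\frac{\ln(1/\lambda)}{\ln\ln(1/\lambda)}\right)$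 as $\lambda\to0^+$. Then $w_0^{k(\lambda)}(\lambda)\ne0$ for all sufficiently small $\lambda>0$, and as $\lambda\to0^+$ $$\frac{w_0^{k(\lambda)}(\lambda)}{\ln(1/\lambda)}-\bar w_0^{k(\lambda)}\to0,\qquad \frac{w_0^{k(\lambda)}(\lambda)}{\|w_0^{k(\lambda)}(\lambda)\|}-\frac{\bar w_0^{k(\lambda)}}{\|\bar w_0^{k(\lambda)}\|}\to0 .$$ -/

import Mathlib

open Filter Topology MeasureTheory Asymptotics

noncomputable section

namespace LocalGD

/-- Parameter and feature space `ℝ^d` with the Euclidean norm. -/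
abbrev Vec (d : ℕ) := EuclideanSpace ℝ (Fin d)

/-- The local feasible set `{w | y_j ⟨x_j, w⟩ ≥ 1 for all j}` of one compute node with samples
`x_1, …, x_N` and labels `y_1, …, y_N`. -/
def feasibleSet {N d : ℕ} (x : Fin N → Vec d) (y : Fin N → ℝ) : Set (Vec d) :=
  {w | ∀ j, 1 ≤ y j * inner ℝ (x j) w}

/-- Local and global separability: every local feasible set is nonempty, and so is their
intersection. -/
def Separable {M N d : ℕ} (X : Fin M → Fin N → Vec d) (Y : Fin M → Fin N → ℝ) : Prop :=
  (∀ i, (feasibleSet (X i) (Y i)).Nonempty) ∧ (⋂ i, feasibleSet (X i) (Y i)).Nonempty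

/-- The local objective: exponential loss plus the weak regularization towards the current
global model `w₀`. -/
def localLoss {N d : ℕ} (x : Fin N → Vec d) (y : Fin N → ℝ) (lam : ℝ) (w₀ w : Vec d) : ℝ :=
  ∑ j, Real.exp (-(y j * inner ℝ (x j) w)) + lam / 2 * ‖w - w₀‖ ^ 2

/-- The local update run until convergence: the minimizer over `ℝ^d` of the local objective.
For `lam > 0` it exists and is unique, see `isMinOn_localUpdate` and `eq_localUpdate`. -/
def localUpdate {N d : ℕ} (x : Fin N → Vec d) (y : Fin N → ℝ) (lam : ℝ) (w₀ : Vec d) : Vec d :=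
  Classical.epsilon fun w => IsMinOn (localLoss x y lam w₀) Set.univ w

/-- `u` is a solution of the local max-margin problem started at `v`: it minimizes `‖w - v‖`
subject to `y_j ⟨x_j, w⟩ ≥ 1` for all `j`. -/
def IsMaxMarginSolution {N d : ℕ} (x : Fin N → Vec d) (y : Fin N → ℝ) (v u : Vec d) : Prop :=
  u ∈ feasibleSet x y ∧ IsMinOn (fun w => ‖w - v‖) (feasibleSet x y) u

/-- The solution of the local max-margin problem, that is, the projection of `v` onto the local
feasible set. If that set is nonempty, it exists and is unique, see
`isMaxMarginSolution_maxMargin` and `eq_maxMargin`. -/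
def maxMargin {N d : ℕ} (x : Fin N → Vec d) (y : Fin N → ℝ) (v : Vec d) : Vec d :=
  Classical.epsilon fun u => IsMaxMarginSolution x y v u

/-- Modified aggregation: starting from `init`, the map `update i` is run on every node `i`, and
`w^{k+1} = (1 - α^k) w^0 + α^k (1/M) ∑ i, update i (w^k)`. -/
def modifiedAggregation {M d : ℕ} (α : ℕ → ℝ) (update : Fin M → Vec d → Vec d) (init : Vec d) :
    ℕ → Vec d
  | 0 => init
  | k + 1 => (1 - α k) • init +
      α k • ((1 / (M : ℝ)) • ∑ i, update i (modifiedAggregation α update init k))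

/-- Global model of Modified Local-GD with regularization parameter `lam`. -/
def modifiedLocalGD {M N d : ℕ} (X : Fin M → Fin N → Vec d) (Y : Fin M → Fin N → ℝ)
    (α : ℕ → ℝ) (init : Vec d) (lam : ℝ) : ℕ → Vec d :=
  modifiedAggregation α (fun i => localUpdate (X i) (Y i) lam) init

/-- Global model of the Modified Parallel Projection Method. -/
def modifiedPPM {M N d : ℕ} (X : Fin M → Fin N → Vec d) (Y : Fin M → Fin N → ℝ)
    (α : ℕ → ℝ) (init : Vec d) : ℕ → Vec d :=
  modifiedAggregation α (fun i => maxMargin (X i) (Y i)) init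

/-- The aggregation weights `α^k = 1 - 1/(k+1)`. -/
def alphaSeq (k : ℕ) : ℝ := 1 - 1 / ((k : ℝ) + 1)

/-- The direction `w / ‖w‖` of a (nonzero) vector. -/
def direction {d : ℕ} (w : Vec d) : Vec d := ‖w‖⁻¹ • w

/-! The two local solutions are well defined. -/

theorem strictConvexOn_localLoss {N d : ℕ} (x : Fin N → Vec d) (y : Fin N → ℝ) {lam : ℝ}
    (hlam : 0 < lam) (w₀ : Vec d) : StrictConvexOn ℝ Set.univ (localLoss x y lam w₀) := by
  have h : StrongConvexOn Set.univ lam (localLoss x y lam w₀) := by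
    rw [strongConvexOn_iff_convex]
    have hs : ∀ t : Finset (Fin N), ConvexOn ℝ Set.univ (fun w : Vec d =>
        ∑ j ∈ t, Real.exp (-(y j * inner ℝ (x j) w))) := by
      intro t
      induction t using Finset.induction_on with
      | empty => simpa using convexOn_const (𝕜 := ℝ) (0 : ℝ) convex_univ
      | insert j t hj ih =>
        have hj' := convexOn_exp.comp_linearMap ((-(y j)) • (innerSL ℝ (x j))).toLinearMap
        have hadd := (show ConvexOn ℝ Set.univ (fun w : Vec d =>
          Real.exp (-(y j * inner ℝ (x j) w))) by
            simpa [Function.comp_def] using hj').add ih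
        refine hadd.congr fun w _ => ?_
        simp [Finset.sum_insert hj]
    have hc := ((hs Finset.univ).add
      ((innerSL ℝ (-(lam • w₀))).toLinearMap.convexOn convex_univ)).add_const
        (lam / 2 * ‖w₀‖ ^ 2)
    refine hc.congr fun w _ => ?_
    simp only [localLoss, Pi.add_apply, ContinuousLinearMap.coe_coe, innerSL_apply_apply,
      inner_neg_left, real_inner_smul_left, norm_sub_sq_real, real_inner_comm w w₀]
    ring
  exact h.strictConvexOn hlam

theorem isMinOn_localUpdate {N d : ℕ} (x : Fin N → Vec d) (y : Fin N → ℝ) {lam : ℝ}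
    (hlam : 0 < lam) (w₀ : Vec d) :
    IsMinOn (localLoss x y lam w₀) Set.univ (localUpdate x y lam w₀) := by
  apply Classical.epsilon_spec (p := fun w => IsMinOn (localLoss x y lam w₀) Set.univ w)
  have hcont : Continuous (localLoss x y lam w₀) := by
    unfold localLoss
    fun_prop
  have hn : Tendsto (fun w : Vec d => ‖w - w₀‖) (cocompact (Vec d)) atTop :=
    tendsto_norm_cocompact_atTop.comp (Homeomorph.subRight w₀).isClosedEmbedding.tendsto_cocompact
  have hlim : Tendsto (localLoss x y lam w₀) (cocompact (Vec d)) atTop := by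
    refine tendsto_atTop_mono (fun w => ?_)
      (((tendsto_pow_atTop two_ne_zero).comp hn).const_mul_atTop (half_pos hlam))
    have : 0 ≤ ∑ j, Real.exp (-(y j * inner ℝ (x j) w)) :=
      Finset.sum_nonneg fun j _ => (Real.exp_pos _).le
    simp only [localLoss, Function.comp_apply]
    linarith
  obtain ⟨w, hw⟩ := hcont.exists_forall_le hlim
  exact ⟨w, fun v _ => hw v⟩

theorem eq_localUpdate {N d : ℕ} (x : Fin N → Vec d) (y : Fin N → ℝ) {lam : ℝ}
    (hlam : 0 < lam) (w₀ w : Vec d) (hw : IsMinOn (localLoss x y lam w₀) Set.univ w) :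
    w = localUpdate x y lam w₀ :=
  (strictConvexOn_localLoss x y hlam w₀).eq_of_isMinOn hw (isMinOn_localUpdate x y hlam w₀)
    (Set.mem_univ _) (Set.mem_univ _)

theorem isClosed_feasibleSet {N d : ℕ} (x : Fin N → Vec d) (y : Fin N → ℝ) :
    IsClosed (feasibleSet x y) := by
  simp only [feasibleSet, Set.ofPred_forall]
  exact isClosed_iInter fun j => isClosed_le continuous_const (by fun_prop)

theorem convex_feasibleSet {N d : ℕ} (x : Fin N → Vec d) (y : Fin N → ℝ) :
    Convex ℝ (feasibleSet x y) := by
  intro u hu v hv a b ha hb hab j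
  have h1 := hu j
  have h2 := hv j
  simp only [inner_add_right, inner_smul_right]
  nlinarith [mul_le_mul_of_nonneg_left h1 ha, mul_le_mul_of_nonneg_left h2 hb]

theorem isMaxMarginSolution_maxMargin {N d : ℕ} (x : Fin N → Vec d) (y : Fin N → ℝ)
    (h : (feasibleSet x y).Nonempty) (v : Vec d) :
    IsMaxMarginSolution x y v (maxMargin x y v) := by
  apply Classical.epsilon_spec (p := fun u => IsMaxMarginSolution x y v u)
  obtain ⟨u, hu, hd⟩ := (isClosed_feasibleSet x y).exists_infDist_eq_dist h v
  refine ⟨u, hu, fun w hw => ?_⟩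
  have := Metric.infDist_le_dist_of_mem (x := v) hw
  rw [hd, dist_comm v u, dist_comm v w, dist_eq_norm, dist_eq_norm] at this
  exact this

theorem eq_maxMargin {N d : ℕ} (x : Fin N → Vec d) (y : Fin N → ℝ) (v u : Vec d)
    (hu : IsMaxMarginSolution x y v u) : u = maxMargin x y v := by
  have hp := isMaxMarginSolution_maxMargin x y ⟨u, hu.1⟩ v
  set p := maxMargin x y v
  have h1 : ‖u - v‖ ≤ ‖p - v‖ := hu.2 hp.1
  have hm : ‖p - v‖ ≤ ‖((1 / 2 : ℝ) • u + (1 / 2 : ℝ) • p) - v‖ :=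
    hp.2 (convex_feasibleSet x y hu.1 hp.1 (by norm_num) (by norm_num) (by norm_num))
  have e1 : ((1 / 2 : ℝ) • u + (1 / 2 : ℝ) • p) - v = (1 / 2 : ℝ) • ((u - v) + (p - v)) := by
    module
  rw [e1, norm_smul, Real.norm_eq_abs, abs_of_pos (by norm_num : (0 : ℝ) < 1 / 2)] at hm
  have hpar := parallelogram_law_with_norm ℝ (u - v) (p - v)
  have e2 : (u - v) - (p - v) = u - p := by abel
  rw [e2] at hpar
  have h0 : ‖u - p‖ = 0 := by
    have := norm_nonneg (u - p)
    nlinarith [norm_nonneg (u - v), norm_nonneg (p - v), norm_nonneg ((u - v) + (p - v))]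
  exact sub_eq_zero.mp (norm_eq_zero.mp h0)

end LocalGD

end

/-!
Write `L = log (1 / lam)` and `z j = y j • x j`. After the rescaling `w = L • u`, the stationarity
condition of the local problem centred at `L • v` reads
`∑ j, exp (-L * (⟪z j, u⟫ - 1)) • z j = L • (u - v)`, while the projection `p` of `v` on the local
feasible set satisfies `∑ j, m j • z j = p - v` with multipliers `m j ≥ 0` supported on the active
constraints. The exponential weights play the role of the multipliers `L * m j`, and the weight of
sample `j` equals `L * m j` as soon as the slack `⟪z j, w⟫ - L` equals `-log (L * m j)`, which is
bounded below by `-log L - O(1)`.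

This is turned into the bound `‖w - L • p‖ = O(log L)`, uniform in bounded `v`
(`GeneralPosition.exists_comparison_const`), by moving `L • p` by `O(log L)` to a point `q` with
these slacks. Constraints with small or zero multipliers need no precise slack: since `exp (-·)` is
decreasing, each sample contributes at most a constant to `‖w - q‖ ^ 2`
(`exp_sub_mul_sub_le_one`). The slacks can be prescribed because, for almost every dataset, the
constraints that are nearly active at any point have linearly independent normals, with uniform
constants (`ae_generalPosition`, `GeneralPosition.exists_uniform_dual_family`). The uniformity in
`v` is essential, since multipliers may be arbitrarily small along the sequence of global models.

The local update is nonexpansive in its centre (`norm_localUpdate_sub_le`), and the iterates of the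
projection method are bounded (`norm_modifiedPPM_sub_le`), so the local errors add up to
`O(k * log L)` after `k` rounds (`exists_residual_bound`). Convergence in direction also needs
the iterates of the projection method to be bounded away from zero, uniformly in the round: they
stay in a fixed circular cone around a common feasible point, because each projection moves a point
along that cone (`exists_norm_modifiedPPM_lower_bound`).
-/

namespace LocalGD

/-! ### A scalar inequality -/

section Scalar

/-- The contribution of one sample to the comparison of the minimizer with an explicit point. Here
`exp (-s)` and `m` are the rescaled dual variables of the two points and `s`, `t` their rescaled
slacks. Either `t` reproduces the dual variable `m` exactly, and the product is nonpositive because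
`exp (-·)` is decreasing, or `t` and `m` are complementary with `m` small, and the product is
bounded by `exp (-s) * s ≤ 1`. -/
theorem exp_sub_mul_sub_le_one {s t m : ℝ} (hm : 0 ≤ m)
    (h : Real.exp (-t) = m ∨ (0 ≤ t ∧ m ≤ 1 ∧ m * t = 0)) :
    (Real.exp (-s) - m) * (s - t) ≤ 1 := by
  have hse : Real.exp (-s) * s ≤ 1 := by
    have h1 : s ≤ Real.exp s := by linarith [Real.add_one_le_exp s]
    calc Real.exp (-s) * s ≤ Real.exp (-s) * Real.exp s :=
          mul_le_mul_of_nonneg_left h1 (Real.exp_pos _).le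
      _ = 1 := by rw [← Real.exp_add]; simp
  rcases h with rfl | ⟨ht, hm1, hmt⟩
  · rcases le_total s t with hst | hst
    · have : Real.exp (-t) ≤ Real.exp (-s) := Real.exp_le_exp.2 (by linarith)
      nlinarith
    · have : Real.exp (-s) ≤ Real.exp (-t) := Real.exp_le_exp.2 (by linarith)
      nlinarith
  · rcases mul_eq_zero.1 hmt with rfl | rfl
    · nlinarith [Real.exp_pos (-s)]
    · rcases le_total 0 s with hs | hs
      · nlinarith [mul_nonneg hm hs]
      · have : 1 ≤ Real.exp (-s) := Real.one_le_exp (by linarith)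
        nlinarith

end Scalar

/-! ### General position and dual families -/

section Dual

variable {ι E : Type*} [NormedAddCommGroup E] [InnerProductSpace ℝ E]

/-- The hyperplanes `{p | ⟪z j, p⟫ = 1}` are in general position: if the normals `z j`, `j ∈ A`,
are linearly dependent, then a linear relation between them witnesses that the equations
`⟪z j, p⟫ = 1`, `j ∈ A`, have no common solution. -/
def GeneralPosition (z : ι → E) : Prop :=
  ∀ A : Finset ι, LinearIndepOn ℝ z A ∨
    ∃ c : ι → ℝ, ∑ j ∈ A, c j • z j = 0 ∧ ∑ j ∈ A, c j ≠ 0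

/-- Linearly independent vectors admit a biorthogonal family. -/
theorem exists_dual_family [FiniteDimensional ℝ E] [DecidableEq ι] {z : ι → E} {A : Set ι}
    (hA : LinearIndepOn ℝ z A) :
    ∃ g : ι → E, ∀ j ∈ A, ∀ k ∈ A, inner ℝ (z j) (g k) = if j = k then (1 : ℝ) else 0 := by
  classical
  have hv : LinearIndependent ℝ (fun a : A => z a) := hA
  have key : ∀ k : ι, ∃ g : E, k ∈ A →
      ∀ j ∈ A, inner ℝ (z j) g = if j = k then (1 : ℝ) else 0 := by
    intro k
    by_cases hk : k ∈ A
    · obtain ⟨f, hf⟩ := LinearMap.exists_extend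
        ((Finsupp.lapply (⟨k, hk⟩ : A)).comp hv.repr : _ →ₗ[ℝ] ℝ)
      refine ⟨(InnerProductSpace.toDual ℝ E).symm (LinearMap.toContinuousLinearMap f),
        fun _ j hj => ?_⟩
      rw [real_inner_comm, InnerProductSpace.toDual_symm_apply]
      have hmem : z j ∈ Submodule.span ℝ (Set.range fun a : A => z a) :=
        Submodule.subset_span ⟨⟨j, hj⟩, rfl⟩
      have h1 := LinearMap.congr_fun hf ⟨z j, hmem⟩
      have h2 : hv.repr ⟨z j, hmem⟩ = Finsupp.single (⟨j, hj⟩ : A) 1 :=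
        hv.repr_eq_single ⟨j, hj⟩ ⟨z j, hmem⟩ rfl
      simp only [LinearMap.comp_apply, Submodule.subtype_apply,
        Finsupp.lapply_apply] at h1
      simp only [LinearMap.coe_toContinuousLinearMap']
      rw [h1]
      have h3 : (hv.repr ⟨z j, hmem⟩) ⟨k, hk⟩ = _ := DFunLike.congr_fun h2 _
      refine h3.trans ?_
      simp [Finsupp.single_apply]
    · exact ⟨0, fun h => absurd h hk⟩
  choose g hg using key
  exact ⟨g, fun j hj k hk => hg k hk j hj⟩

/-- In general position, the constraints that are active up to `ε` at a point `p` have linearly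
independent normals, for one `ε` that serves all points of the space. Since there are finitely many
sets of constraints, the biorthogonal families have a common bound too. This makes all later
estimates uniform in the point that is projected. -/
theorem GeneralPosition.exists_uniform_dual_family [FiniteDimensional ℝ E] [Fintype ι]
    [DecidableEq ι] {z : ι → E} (hz : GeneralPosition z) :
    ∃ ε > 0, ∃ K : ℝ, 0 ≤ K ∧ ∀ p : E, ∃ g : ι → E, (∀ k, ‖g k‖ ≤ K) ∧
      ∀ j k, |inner ℝ (z j) p - 1| ≤ ε → |inner ℝ (z k) p - 1| ≤ ε →
        inner ℝ (z j) (g k) = if j = k then (1 : ℝ) else 0 := by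
  classical
  have key : ∀ A : Finset ι, ∃ ε > 0, ∃ g : ι → E, ∀ p : E,
      (∀ j ∈ A, |inner ℝ (z j) p - 1| ≤ ε) → ∀ j ∈ A, ∀ k ∈ A,
        inner ℝ (z j) (g k) = if j = k then (1 : ℝ) else 0 := by
    intro A
    rcases hz A with hA | ⟨c, hc0, hc1⟩
    · obtain ⟨g, hg⟩ := exists_dual_family hA
      exact ⟨1, one_pos, g, fun p _ j hj k hk => hg j hj k hk⟩
    -- The relation gives `|∑ c j| = |∑ c j * (⟪z j, p⟫ - 1)| ≤ ε * ∑ |c j|`, so a dependent set is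
    -- never active up to this `ε`; the summand `1` only keeps the denominator positive.
    · have hS : 0 < |∑ j ∈ A, c j| := abs_pos.2 hc1
      have hT : 0 ≤ ∑ j ∈ A, |c j| := Finset.sum_nonneg fun _ _ => abs_nonneg _
      refine ⟨|∑ j ∈ A, c j| / (∑ j ∈ A, |c j| + 1), by positivity, 0, fun p hp => ?_⟩
      exfalso
      set ε := |∑ j ∈ A, c j| / (∑ j ∈ A, |c j| + 1) with hε
      have hε0 : 0 < ε := by positivity
      have e1 : ∑ j ∈ A, c j * (inner ℝ (z j) p - 1) = -∑ j ∈ A, c j := by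
        have : inner ℝ (∑ j ∈ A, c j • z j) p = 0 := by rw [hc0, inner_zero_left]
        simp only [sum_inner, real_inner_smul_left] at this
        simp only [mul_sub, Finset.sum_sub_distrib, this, mul_one, zero_sub]
      have e2 : |∑ j ∈ A, c j| ≤ (∑ j ∈ A, |c j|) * ε := by
        rw [← abs_neg, ← e1, Finset.sum_mul]
        refine (Finset.abs_sum_le_sum_abs _ _).trans (Finset.sum_le_sum fun j hj => ?_)
        rw [abs_mul]
        exact mul_le_mul_of_nonneg_left (hp j hj) (abs_nonneg _)
      have e3 : |∑ j ∈ A, c j| = (∑ j ∈ A, |c j| + 1) * ε := by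
        rw [hε]; field_simp
      linarith
  choose ε hε g hg using key
  have hne : (Finset.univ : Finset (Finset ι)).Nonempty := ⟨∅, Finset.mem_univ _⟩
  refine ⟨Finset.univ.inf' hne ε, (Finset.lt_inf'_iff hne).2 fun A _ => hε A,
    ∑ A, ∑ k, ‖g A k‖, by positivity, fun p => ?_⟩
  set ε₀ := Finset.univ.inf' hne ε
  set A : Finset ι := Finset.univ.filter fun j => |inner ℝ (z j) p - 1| ≤ ε₀ with hA
  refine ⟨g A, fun k => ?_, fun j k hj hk => ?_⟩
  · calc ‖g A k‖ ≤ ∑ k, ‖g A k‖ :=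
          Finset.single_le_sum (f := fun k => ‖g A k‖) (fun _ _ => norm_nonneg _)
            (Finset.mem_univ k)
      _ ≤ _ := Finset.single_le_sum (f := fun A => ∑ k, ‖g A k‖)
          (fun _ _ => Finset.sum_nonneg fun _ _ => norm_nonneg _) (Finset.mem_univ A)
  · refine hg A p (fun i hi => ?_) j (by simp [hA, hj]) k (by simp [hA, hk])
    exact (Finset.mem_filter.1 hi).2.trans (Finset.inf'_le _ (Finset.mem_univ A))

end Dual

/-! ### Almost every dataset is in general position -/

section Genericity

variable {d : ℕ}

/-- A proper subspace of `ℝ^d × ℝ` meets the parallel hyperplane at height `y ≠ 0` in a proper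
affine subspace, which is a null set. -/
theorem ae_prodMk_notMem {y : ℝ} (hy : y ≠ 0) {S : Submodule ℝ (Vec d × ℝ)} (hS : S ≠ ⊤)
    (x₀ : Vec d) : ∀ᵐ x : Vec d, (x₀ + x, y) ∉ S := by
  let f : Vec d →ᵃ[ℝ] Vec d × ℝ :=
    (LinearMap.inl ℝ (Vec d) ℝ).toAffineMap + AffineMap.const ℝ (Vec d) (x₀, y)
  have hf : ∀ x, f x = (x₀ + x, y) := fun x => by simp [f, add_comm]
  have hne : S.toAffineSubspace.comap f ≠ ⊤ := by
    intro htop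
    have hmem : ∀ x : Vec d, (x, y) ∈ S := fun x => by
      have : x - x₀ ∈ S.toAffineSubspace.comap f := htop ▸ AffineSubspace.mem_top _ _ _
      simpa [hf] using this
    -- `(a, b) = (a, y) - (0, y) + (b / y) • (0, y)`
    refine hS (eq_top_iff.2 fun ⟨a, b⟩ _ => ?_)
    have h2 := S.sub_mem (hmem a) (hmem 0)
    have h3 := S.add_mem h2 (S.smul_mem (b / y) (hmem 0))
    simpa [hy] using h3
  have := Measure.addHaar_affineSubspace (volume : Measure (Vec d)) _ hne
  refine measure_mono_null (fun x hx => ?_) this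
  simpa [hf] using hx

/-- For almost every dataset, at most `d + 1` samples of a node, extended by their labels to vectors of
`ℝ^d × ℝ`, are linearly independent: the samples are added one at a time, and each new one only has
to avoid the span of at most `d` earlier ones. -/
theorem ae_linearIndepOn_prodMk {M N : ℕ} (i : Fin M) (y : Fin N → ℝ) (hy : ∀ j, y j ≠ 0)
    (B : Finset (Fin N)) (hB : B.card ≤ d + 1) :
    ∀ᵐ X : Fin M → Fin N → Vec d, LinearIndepOn ℝ (fun j => (X i j, y j)) (B : Set (Fin N)) := by
  have hopen : ∀ B : Finset (Fin N), MeasurableSet {X : Fin M → Fin N → Vec d |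
      LinearIndepOn ℝ (fun j => (X i j, y j)) (B : Set (Fin N))} := by
    intro B
    have hc : Continuous fun (X : Fin M → Fin N → Vec d) (j : (B : Set (Fin N))) =>
        (X i j, y j) := by fun_prop
    exact ((isOpen_setOfPred_linearIndependent (𝕜 := ℝ)).preimage hc).measurableSet
  induction B using Finset.induction_on with
  | empty => simp
  | insert j B hj ih =>
    have hcard : B.card ≤ d := by
      rw [Finset.card_insert_of_notMem hj] at hB; omega
    -- Only the new sample is moved, so the independence of the earlier ones enters as an
    -- alternative that does not change along the motion.
    have hstep : ∀ᵐ X : Fin M → Fin N → Vec d,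
        X ∈ {X | LinearIndepOn ℝ (fun j => (X i j, y j)) (B : Set (Fin N))}ᶜ ∪
          {X | LinearIndepOn ℝ (fun j => (X i j, y j))
            ((insert j B : Finset (Fin N)) : Set (Fin N))} := by
      have : (volume : Measure (Fin N → Vec d)).IsAddHaarMeasure :=
        inferInstanceAs (Measure.pi _).IsAddHaarMeasure
      have : (volume : Measure (Fin M → Fin N → Vec d)).IsAddHaarMeasure :=
        inferInstanceAs (Measure.pi _).IsAddHaarMeasure
      refine ae_mem_of_ae_add_linearMap_mem
        ((LinearMap.single ℝ (fun _ : Fin M => Fin N → Vec d) i).comp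
          (LinearMap.single ℝ (fun _ : Fin N => Vec d) j)) (volume : Measure (Vec d)) volume
        ((hopen B).compl.union (hopen _)) fun X => ?_
      by_cases hX : LinearIndepOn ℝ (fun j => (X i j, y j)) (B : Set (Fin N))
      · set S := Submodule.span ℝ ((fun j => (X i j, y j)) '' (B : Set (Fin N))) with hSdef
        have hS : S ≠ ⊤ := by
          intro htop
          have h1 : Module.finrank ℝ S ≤ B.card := by
            have h := finrank_span_finset_le_card (R := ℝ) (B.image fun j => (X i j, y j))
            rw [Finset.coe_image] at h
            exact h.trans Finset.card_image_le
          rw [htop, finrank_top] at h1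
          simp at h1
          omega
        filter_upwards [ae_prodMk_notMem (hy j) hS (X i j)] with x hx
        right
        have hEq : ∀ k ∈ B, ((X + ((LinearMap.single ℝ (fun _ : Fin M => Fin N → Vec d) i).comp
          (LinearMap.single ℝ (fun _ : Fin N => Vec d) j)) x) i k, y k) = (X i k, y k) := by
          intro k hk
          have : k ≠ j := fun h => hj (h ▸ hk)
          simp [this]
        simp only [Set.mem_ofPred_eq, Finset.coe_insert]
        rw [linearIndepOn_insert (by simpa using hj)]
        refine ⟨hX.congr fun k hk => (hEq k hk).symm, ?_⟩
        rw [Set.image_congr hEq]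
        simpa using hx
      · refine Eventually.of_forall fun x => Or.inl ?_
        simp only [Set.mem_compl_iff, Set.mem_ofPred_eq]
        refine fun h => hX (h.congr fun k hk => ?_)
        have : k ≠ j := fun h => hj (h ▸ hk)
        simp [this]
    filter_upwards [hstep, ih (by omega)] with X hX hX'
    exact hX.resolve_left fun h => h hX'

/-- A relation among the signed samples `y j • x j` whose coefficients sum to zero is a relation among
the extended samples `(x j, y j)`, because `y j * y j = 1`. A dependent set with more than `d + 1`
elements is replaced by a subset with `d + 1` elements, which is still dependent. -/
theorem generalPosition_of_linearIndepOn_prodMk {N : ℕ} {x : Fin N → Vec d} {y : Fin N → ℝ}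
    (hy : ∀ j, y j = 1 ∨ y j = -1)
    (h : ∀ B : Finset (Fin N), B.card ≤ d + 1 →
      LinearIndepOn ℝ (fun j => (x j, y j)) (B : Set (Fin N))) :
    GeneralPosition fun j => y j • x j := by
  classical
  have key : ∀ B : Finset (Fin N), B.card ≤ d + 1 → ∀ c : Fin N → ℝ,
      ∑ j ∈ B, c j • y j • x j = 0 → ∑ j ∈ B, c j = 0 → ∀ j ∈ B, c j = 0 := by
    intro B hB c h1 h2 j hj
    have hl := linearIndepOn_finset_iff.1 (h B hB) (fun j => c j * y j) ?_ j hj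
    · rcases hy j with e | e <;> simpa [e] using hl
    · refine Prod.ext ?_ ?_
      · simpa [Prod.fst_sum, mul_smul] using h1
      · rw [Prod.snd_sum, Prod.snd_zero, ← h2]
        refine Finset.sum_congr rfl fun k _ => ?_
        rcases hy k with e | e <;> simp [e]
  intro A
  by_contra! hcon
  obtain ⟨hdep, hrel⟩ := hcon
  obtain ⟨B, hBA, hB, hBd⟩ : ∃ B ⊆ A, B.card ≤ d + 1 ∧
      ¬ LinearIndepOn ℝ (fun j => y j • x j) (B : Set (Fin N)) := by
    rcases le_or_gt A.card (d + 1) with hA | hA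
    · exact ⟨A, subset_rfl, hA, hdep⟩
    · obtain ⟨B, hBA, hB⟩ := Finset.exists_subset_card_eq hA.le
      refine ⟨B, hBA, hB.le, fun hl => ?_⟩
      have := LinearIndependent.fintype_card_le_finrank hl
      simp [hB] at this
  simp only [linearIndepOn_finset_iff, not_forall] at hBd
  obtain ⟨c, hc, j, hj, hcj⟩ := hBd
  refine hcj (key B hB c hc ?_ j hj)
  have := hrel (fun j => if j ∈ B then c j else 0) ?_
  · simpa [Finset.sum_ite_mem, Finset.inter_eq_right.2 hBA] using this
  · simpa [Finset.sum_ite_mem, Finset.inter_eq_right.2 hBA] using hc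

theorem ae_generalPosition (M N d : ℕ) :
    ∀ᵐ X : Fin M → Fin N → Vec d, ∀ Y : Fin M → Fin N → ℝ, (∀ i j, Y i j = 1 ∨ Y i j = -1) →
      ∀ i, GeneralPosition fun j => Y i j • X i j := by
  -- The labellings by `±1` are finitely many, so the exceptional null set can be chosen independently
  -- of the labels.
  have hcount : {y : Fin N → ℝ | ∀ j, y j = 1 ∨ y j = -1}.Countable := by
    have := Set.Finite.pi' (ι := Fin N) (t := fun _ => ({1, -1} : Set ℝ)) fun _ => Set.toFinite _
    exact this.countable
  have h : ∀ᵐ X : Fin M → Fin N → Vec d, ∀ y ∈ {y : Fin N → ℝ | ∀ j, y j = 1 ∨ y j = -1},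
      ∀ i : Fin M, ∀ B : Finset (Fin N), B.card ≤ d + 1 →
        LinearIndepOn ℝ (fun j => (X i j, y j)) (B : Set (Fin N)) := by
    rw [ae_ball_iff hcount]
    intro y hy
    have hy0 : ∀ j, y j ≠ 0 := fun j => by rcases hy j with e | e <;> simp [e]
    simp only [ae_all_iff]
    exact fun i B hB => ae_linearIndepOn_prodMk i y hy0 B hB
  filter_upwards [h] with X hX Y hY i
  exact generalPosition_of_linearIndepOn_prodMk (hY i) (hX (Y i) (hY i) i)

end Genericity

/-! ### Comparison of a stationary point with a projection -/

section Comparison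

variable {ι E : Type*} [Fintype ι] [NormedAddCommGroup E] [InnerProductSpace ℝ E]

/-- A direction that does not decrease the active constraints can be followed for a short time
without leaving the polyhedron, so a vector `n` that satisfies the variational inequality at `p`
makes a nonnegative inner product with it. -/
theorem inner_nonneg_of_feasible_direction {z : ι → E} {p n h : E}
    (hp : ∀ j, 1 ≤ inner ℝ (z j) p)
    (hvi : ∀ u, (∀ j, 1 ≤ inner ℝ (z j) u) → 0 ≤ inner ℝ n (u - p))
    (hh : ∀ j, inner ℝ (z j) p = 1 → 0 ≤ inner ℝ (z j) h) : 0 ≤ inner ℝ n h := by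
  have hev : ∀ᶠ t in 𝓝[>] (0 : ℝ), ∀ j, 1 ≤ inner ℝ (z j) (p + t • h) := by
    rw [eventually_all]
    intro j
    rcases (hp j).eq_or_lt with hj | hj
    · filter_upwards [self_mem_nhdsWithin] with t ht
      have := mul_nonneg (le_of_lt ht) (hh j hj.symm)
      rw [inner_add_right, real_inner_smul_right]
      linarith
    · have hc : Continuous fun t : ℝ => inner ℝ (z j) (p + t • h) := by fun_prop
      have := (hc.tendsto 0).eventually (lt_mem_nhds (a := 1) (by simpa using hj))
      exact (this.filter_mono nhdsWithin_le_nhds).mono fun t ht => le_of_lt ht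
  obtain ⟨t, ht, ht0⟩ := (hev.and self_mem_nhdsWithin).exists
  have := hvi _ ht
  rw [add_sub_cancel_left, real_inner_smul_right] at this
  exact nonneg_of_mul_nonneg_right this ht0

/-- Karush-Kuhn-Tucker multipliers of a projection. The multiplier of an active constraint is
`⟪n, g j⟫`, where `g` is biorthogonal to the active normals; in particular it is bounded by
`‖n‖ * ‖g j‖`. -/
theorem exists_kkt_multipliers [DecidableEq ι] {z g : ι → E} {p n : E}
    (hp : ∀ j, 1 ≤ inner ℝ (z j) p)
    (hvi : ∀ u, (∀ j, 1 ≤ inner ℝ (z j) u) → 0 ≤ inner ℝ n (u - p))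
    (hg : ∀ j k, inner ℝ (z j) p = 1 → inner ℝ (z k) p = 1 →
      inner ℝ (z j) (g k) = if j = k then (1 : ℝ) else 0) :
    ∃ m : ι → ℝ, (∀ j, 0 ≤ m j) ∧ (∀ j, inner ℝ (z j) p ≠ 1 → m j = 0) ∧
      (∀ j, m j ≤ ‖n‖ * ‖g j‖) ∧ ∀ h, ∑ j, m j * inner ℝ (z j) h = inner ℝ n h := by
  have hdir := fun h => inner_nonneg_of_feasible_direction (h := h) hp hvi
  refine ⟨fun j => if inner ℝ (z j) p = 1 then inner ℝ n (g j) else 0, fun j => ?_,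
    fun j hj => by simp [hj], fun j => ?_, fun h => ?_⟩
  · dsimp only
    split_ifs with hj
    · refine hdir _ fun i hi => ?_
      rw [hg i j hi hj]
      split_ifs <;> norm_num
    · exact le_rfl
  · dsimp only
    split_ifs with hj
    · exact real_inner_le_norm _ _
    · positivity
  -- Removing from `h` its components along the active normals leaves a vector `r` such that both
  -- `r` and `-r` are feasible directions.
  · set r : E := h - ∑ k, if inner ℝ (z k) p = 1 then inner ℝ (z k) h • g k else 0 with hr
    have hr0 : ∀ j, inner ℝ (z j) p = 1 → inner ℝ (z j) r = 0 := by
      intro j hj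
      rw [hr, inner_sub_right, inner_sum, Finset.sum_eq_single j]
      · rw [if_pos hj, real_inner_smul_right, hg j j hj hj]; simp
      · intro k _ hk
        split_ifs with hk1
        · rw [real_inner_smul_right, hg j k hj hk1, if_neg hk.symm, mul_zero]
        · simp
      · simp
    have h1 : 0 ≤ inner ℝ n r := hdir r fun j hj => (hr0 j hj).ge
    have h2 : 0 ≤ inner ℝ n (-r) := hdir (-r) fun j hj => by
      rw [inner_neg_right, hr0 j hj, neg_zero]
    have h3 : inner ℝ n r = 0 := by rw [inner_neg_right] at h2; linarith
    rw [hr, inner_sub_right, inner_sum, sub_eq_zero] at h3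
    rw [h3]
    refine Finset.sum_congr rfl fun k _ => ?_
    by_cases hk : inner ℝ (z k) p = 1
    · simp only [if_pos hk, real_inner_smul_right, mul_comm]
    · simp only [if_neg hk, inner_zero_right, zero_mul]

/-- Comparison of the stationary point `w` with a point `q` that nearly satisfies the same stationarity
condition. With slacks `s j = ⟪z j, w⟫ - L` and `t j = ⟪z j, q⟫ - L`, subtracting the two conditions
and pairing with `w - q` gives
`‖w - q‖ ^ 2 = ∑ j, (exp (-s j) - L * m j) * (s j - t j) - ⟪q - L • p, w - q⟫`,
and every summand is at most `1` by `exp_sub_mul_sub_le_one`. -/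
theorem norm_sub_le_of_stationary {z : ι → E} {v p w q : E} {L : ℝ} {m : ι → ℝ}
    (hL : 0 ≤ L) (hm : ∀ j, 0 ≤ m j)
    (hkkt : ∀ h, ∑ j, m j * inner ℝ (z j) h = inner ℝ (p - v) h)
    (hw : ∀ h, ∑ j, Real.exp (-(inner ℝ (z j) w - L)) * inner ℝ (z j) h = inner ℝ (w - L • v) h)
    (hq : ∀ j, Real.exp (-(inner ℝ (z j) q - L)) = L * m j ∨
      (0 ≤ inner ℝ (z j) q - L ∧ L * m j ≤ 1 ∧ L * m j * (inner ℝ (z j) q - L) = 0)) :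
    ‖w - q‖ ≤ Fintype.card ι + 1 + ‖q - L • p‖ := by
  have hsum : ‖w - q‖ ^ 2 ≤ Fintype.card ι + ‖q - L • p‖ * ‖w - q‖ := by
    have e : w - q = (w - L • v) - L • (p - v) - (q - L • p) := by module
    have e2 : ‖w - q‖ ^ 2 = ∑ j, (Real.exp (-(inner ℝ (z j) w - L)) - L * m j) *
        ((inner ℝ (z j) w - L) - (inner ℝ (z j) q - L)) - inner ℝ (q - L • p) (w - q) := by
      rw [← real_inner_self_eq_norm_sq]
      nth_rewrite 1 [e]
      rw [inner_sub_left, inner_sub_left, real_inner_smul_left, ← hw, ← hkkt, Finset.mul_sum,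
        ← Finset.sum_sub_distrib]
      congr 1
      refine Finset.sum_congr rfl fun j _ => ?_
      rw [inner_sub_right]
      ring
    have h1 : ∑ j, (Real.exp (-(inner ℝ (z j) w - L)) - L * m j) *
        ((inner ℝ (z j) w - L) - (inner ℝ (z j) q - L)) ≤ ∑ _j : ι, (1 : ℝ) :=
      Finset.sum_le_sum fun j _ => exp_sub_mul_sub_le_one (mul_nonneg hL (hm j)) (hq j)
    simp only [Finset.sum_const, Finset.card_univ, nsmul_eq_mul, mul_one] at h1
    have h2 := neg_le_of_abs_le (abs_real_inner_le_norm (q - L • p) (w - q))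
    linarith
  by_contra! hlt
  have h1 : (0 : ℝ) ≤ Fintype.card ι := Nat.cast_nonneg _
  nlinarith [norm_nonneg (q - L • p), norm_nonneg (w - q)]

/-- The local estimate. If `p` is the projection of `v` on the polyhedron
`{u | ∀ j, 1 ≤ ⟪z j, u⟫}` and `w` is stationary for the exponential loss with regularization `exp (-L)` centred at `L • v`, then
`w` and `L • p` differ by `O(log L)`, uniformly in `v` as long as `v` is within distance `R` of the
polyhedron. -/
theorem GeneralPosition.exists_comparison_const [FiniteDimensional ℝ E] {z : ι → E}
    (hz : GeneralPosition z) (R : ℝ) :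
    ∃ C : ℝ, ∀ᶠ L : ℝ in atTop, ∀ v p w : E, ‖p - v‖ ≤ R → (∀ j, 1 ≤ inner ℝ (z j) p) →
      (∀ u, (∀ j, 1 ≤ inner ℝ (z j) u) → 0 ≤ inner ℝ (p - v) (u - p)) →
      (∀ h, ∑ j, Real.exp (-(inner ℝ (z j) w - L)) * inner ℝ (z j) h =
        inner ℝ (w - L • v) h) →
      ‖w - L • p‖ ≤ C * Real.log L := by
  classical
  obtain ⟨ε, hε, K, hK, hgp⟩ := hz.exists_uniform_dual_family
  set B : ℝ := max 1 (R * K) with hB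
  set n : ℝ := (Fintype.card ι : ℝ) with hn
  have hn0 : 0 ≤ n := Nat.cast_nonneg _
  have hB1 : 1 ≤ B := le_max_left _ _
  have hlogB : 0 ≤ Real.log B := Real.log_nonneg hB1
  set D : ℝ := n * ((1 + Real.log B) * K) with hD
  have hD0 : 0 ≤ D := by positivity
  have hev : ∀ᶠ L : ℝ in atTop, ∀ j, ‖z j‖ * (D * Real.log L) ≤ ε * L := by
    rw [eventually_all]
    intro j
    have h := (Real.isLittleO_log_id_atTop.const_mul_left (‖z j‖ * D)).def hε
    filter_upwards [h, eventually_ge_atTop 1] with L hL hL1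
    have := (le_abs_self _).trans hL
    rw [id, Real.norm_of_nonneg (by linarith)] at this
    linarith
  refine ⟨n + 1 + 2 * D, ?_⟩
  filter_upwards [hev, eventually_ge_atTop 1,
    Real.tendsto_log_atTop.eventually_ge_atTop 1] with L hLz hL1 hlog v p w hR hp hvi hw
  obtain ⟨g, hgK, hg⟩ := hgp p
  obtain ⟨m, hm0, hmact, hmle, hkkt⟩ := exists_kkt_multipliers (g := g) hp hvi
    (fun j k hj hk => hg j k (by simp [hj, hε.le]) (by simp [hk, hε.le]))
  have hmB : ∀ j, m j ≤ B := fun j => (hmle j).trans <| (mul_le_mul hR (hgK j) (norm_nonneg _)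
    ((norm_nonneg _).trans hR)).trans (le_max_right _ _)
  -- A sample with multiplier `m k` wants the slack `-log (L * m k)`. The correction `β` realizes it
  -- when `1 ≤ L * m k`. For smaller multipliers the wanted slack is positive, possibly huge, and
  -- slack zero is good enough.
  set β : ι → ℝ := fun k => -Real.log (max 1 (L * m k)) with hβ
  have hβle : ∀ k, |β k| ≤ (1 + Real.log B) * Real.log L := by
    intro k
    have h1 : 0 ≤ Real.log (max 1 (L * m k)) := Real.log_nonneg (le_max_left _ _)
    have h2 : max 1 (L * m k) ≤ L * B :=
      max_le (by nlinarith) (mul_le_mul_of_nonneg_left (hmB k) (by linarith))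
    have h3 : Real.log (max 1 (L * m k)) ≤ Real.log (L * B) :=
      Real.log_le_log (lt_of_lt_of_le one_pos (le_max_left _ _)) h2
    rw [Real.log_mul (by linarith) (by linarith)] at h3
    simp only [hβ, abs_neg, abs_of_nonneg h1]
    nlinarith
  set q : E := L • p + ∑ k, β k • g k with hq
  have hqp : ‖q - L • p‖ ≤ D * Real.log L := by
    rw [hq, add_sub_cancel_left]
    calc ‖∑ k, β k • g k‖ ≤ ∑ k, ‖β k • g k‖ := norm_sum_le _ _
      _ ≤ ∑ _k : ι, (1 + Real.log B) * Real.log L * K := by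
          refine Finset.sum_le_sum fun k _ => ?_
          rw [norm_smul]
          exact mul_le_mul (hβle k) (hgK k) (norm_nonneg _) ((abs_nonneg _).trans (hβle k))
      _ = D * Real.log L := by
          simp only [Finset.sum_const, Finset.card_univ, nsmul_eq_mul, hD, hn]; ring
  have hqz : ∀ j, inner ℝ (z j) q - L =
      L * (inner ℝ (z j) p - 1) + inner ℝ (z j) (∑ k, β k • g k) := fun j => by
    rw [hq, inner_add_right, real_inner_smul_right]; ring
  have hmain := norm_sub_le_of_stationary (q := q) (by linarith) hm0 hkkt hw fun j => ?_
  · have : ‖w - L • p‖ ≤ ‖w - q‖ + ‖q - L • p‖ := norm_sub_le_norm_sub_add_norm_sub _ _ _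
    rw [← hn] at hmain
    nlinarith
  -- Constraints active up to `ε` see only their own correction, by biorthogonality; the others have
  -- slack at least `ε * L`, which dominates the `O(log L)` displacement.
  by_cases hj : |inner ℝ (z j) p - 1| ≤ ε
  · have hβ0 : ∀ k, inner ℝ (z k) p ≠ 1 → β k = 0 := fun k hk => by
      simp [hβ, hmact k hk]
    have hsum : inner ℝ (z j) (∑ k, β k • g k) = β j := by
      rw [inner_sum, Finset.sum_eq_single j]
      · rw [real_inner_smul_right, hg j j hj hj]; simp
      · intro k _ hk
        by_cases hk1 : inner ℝ (z k) p = 1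
        · rw [real_inner_smul_right, hg j k hj (by simp [hk1, hε.le]), if_neg hk.symm, mul_zero]
        · simp [hβ0 k hk1]
      · simp
    rw [hqz, hsum]
    rcases le_or_gt 1 (L * m j) with h1 | h1
    · left
      have hact : inner ℝ (z j) p = 1 := by
        by_contra hne
        rw [hmact j hne] at h1
        norm_num at h1
      simp only [hact, hβ, max_eq_right h1, sub_self, mul_zero, zero_add, neg_neg]
      exact Real.exp_log (by linarith)
    · right
      have hb : β j = 0 := by simp [hβ, max_eq_left h1.le]
      rw [hb, add_zero]
      refine ⟨mul_nonneg (by linarith) (by linarith [hp j]), h1.le, ?_⟩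
      by_cases hact : inner ℝ (z j) p = 1
      · simp [hact]
      · simp [hmact j hact]
  · right
    have hact : inner ℝ (z j) p ≠ 1 := fun h => hj (by simp [h, hε.le])
    rw [hmact j hact]
    refine ⟨?_, by norm_num, by simp⟩
    have h1 : ε < inner ℝ (z j) p - 1 := by
      rw [abs_of_nonneg (by linarith [hp j])] at hj
      exact not_le.1 hj
    have h2 := neg_le_of_abs_le (abs_real_inner_le_norm (z j) (q - L • p))
    have h3 := mul_le_mul_of_nonneg_left hqp (norm_nonneg (z j))
    have h4 := hLz j
    rw [hqz]
    have h5 : q - L • p = ∑ k, β k • g k := by rw [hq, add_sub_cancel_left]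
    rw [h5] at h2 h3
    nlinarith

end Comparison

/-! ### First-order conditions for the local problems -/

section LocalSolutions

variable {N d : ℕ} {x : Fin N → Vec d} {y : Fin N → ℝ}

/-- The vanishing of the derivative of the local objective at its minimizer, in direction `h`. -/
theorem localUpdate_stationary (x : Fin N → Vec d) (y : Fin N → ℝ) {lam : ℝ} (hlam : 0 < lam)
    (w₀ h : Vec d) :
    ∑ j, Real.exp (-(y j * inner ℝ (x j) (localUpdate x y lam w₀))) * (y j * inner ℝ (x j) h) =
      lam * inner ℝ (localUpdate x y lam w₀ - w₀) h := by
  set w := localUpdate x y lam w₀ with hw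
  have hmin : IsLocalMin (fun t : ℝ => localLoss x y lam w₀ (w + t • h)) 0 := by
    refine Eventually.of_forall fun t => ?_
    simpa using isMinOn_localUpdate x y hlam w₀ (Set.mem_univ (w + t • h))
  have hexp : ∀ j, HasDerivAt (fun t : ℝ => Real.exp (-(y j * inner ℝ (x j) (w + t • h))))
      (Real.exp (-(y j * inner ℝ (x j) w)) * -(y j * inner ℝ (x j) h)) 0 := by
    intro j
    have h1 : HasDerivAt (fun t : ℝ => -(y j * inner ℝ (x j) (w + t • h)))
        (-(y j * inner ℝ (x j) h)) 0 := by
      have := ((((hasDerivAt_id (0 : ℝ)).mul_const (inner ℝ (x j) h)).const_add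
        (inner ℝ (x j) w)).const_mul (y j)).neg
      simp only [one_mul] at this
      refine this.congr_of_eventuallyEq (Eventually.of_forall fun t => ?_)
      simp [inner_add_right, real_inner_smul_right]
    simpa using h1.exp
  have hsq : HasDerivAt (fun t : ℝ => ‖w + t • h - w₀‖ ^ 2) (2 * inner ℝ (w - w₀) h) 0 := by
    have h1 : HasDerivAt (fun t : ℝ => w + t • h - w₀) h 0 := by
      simpa using (((hasDerivAt_id (0 : ℝ)).smul_const h).const_add w).sub_const w₀
    simpa using h1.norm_sq
  have hder := (HasDerivAt.fun_sum fun j (_ : j ∈ Finset.univ) => hexp j).add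
    (hsq.const_mul (lam / 2))
  have h0 := hmin.hasDerivAt_eq_zero hder
  simp only [mul_neg, Finset.sum_neg_distrib] at h0
  linarith

/-- The local update is the proximal map of a convex function, hence nonexpansive in its centre. -/
theorem norm_localUpdate_sub_le {lam : ℝ} (hlam : 0 < lam) (a b : Vec d) :
    ‖localUpdate x y lam a - localUpdate x y lam b‖ ≤ ‖a - b‖ := by
  set w := localUpdate x y lam a
  set w' := localUpdate x y lam b
  have h1 := localUpdate_stationary x y hlam a (w - w')
  have h2 := localUpdate_stationary x y hlam b (w - w')
  have h3 : ∑ j, Real.exp (-(y j * inner ℝ (x j) w)) * (y j * inner ℝ (x j) (w - w')) ≤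
      ∑ j, Real.exp (-(y j * inner ℝ (x j) w')) * (y j * inner ℝ (x j) (w - w')) := by
    refine Finset.sum_le_sum fun j _ => ?_
    have e : y j * inner ℝ (x j) (w - w') = y j * inner ℝ (x j) w - y j * inner ℝ (x j) w' := by
      rw [inner_sub_right, mul_sub]
    rw [e]
    rcases le_total (y j * inner ℝ (x j) w) (y j * inner ℝ (x j) w') with hle | hle
    · have := Real.exp_le_exp.2 (neg_le_neg hle)
      nlinarith
    · have := Real.exp_le_exp.2 (neg_le_neg hle)
      nlinarith
  rw [h1, h2] at h3
  have h4 := le_of_mul_le_mul_left h3 hlam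
  have h5 : ‖w - w'‖ ^ 2 ≤ inner ℝ (a - b) (w - w') := by
    rw [← real_inner_self_eq_norm_sq]
    have e : w - w' = (w - a) - (w' - b) + (a - b) := by abel
    nth_rewrite 1 [e]
    rw [inner_add_left, inner_sub_left]
    linarith
  have h6 := h5.trans (real_inner_le_norm (a - b) (w - w'))
  by_contra! hlt
  nlinarith [norm_nonneg (a - b)]

/-- The variational inequality of the projection on the local feasible set. -/
theorem inner_maxMargin_sub_nonneg (h : (feasibleSet x y).Nonempty) (v : Vec d) {u : Vec d}
    (hu : u ∈ feasibleSet x y) : 0 ≤ inner ℝ (maxMargin x y v - v) (u - maxMargin x y v) := by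
  obtain ⟨hp, hmin⟩ := isMaxMarginSolution_maxMargin x y h v
  set p := maxMargin x y v
  have hinf : ‖v - p‖ = ⨅ w : feasibleSet x y, ‖v - w‖ := by
    have : Nonempty (feasibleSet x y) := ⟨⟨p, hp⟩⟩
    refine le_antisymm (le_ciInf fun w => ?_)
      (ciInf_le ⟨0, by rintro _ ⟨w, rfl⟩; exact norm_nonneg _⟩ (⟨p, hp⟩ : feasibleSet x y))
    rw [norm_sub_rev v p, norm_sub_rev v w]
    exact hmin w.2
  have := (norm_eq_iInf_iff_real_inner_le_zero (convex_feasibleSet x y) hp).1 hinf u hu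
  rw [← neg_sub v p, inner_neg_left]
  linarith

theorem norm_maxMargin_sub_le (v : Vec d) {c : Vec d} (hc : c ∈ feasibleSet x y) :
    ‖maxMargin x y v - c‖ ≤ ‖v - c‖ := by
  have h := inner_maxMargin_sub_nonneg ⟨c, hc⟩ v hc
  set p := maxMargin x y v
  have e : v - c = -((p - v) + (c - p)) := by abel
  rw [e, norm_neg, norm_sub_rev p c]
  refine le_of_sq_le_sq ?_ (norm_nonneg _)
  rw [norm_add_sq_real]
  nlinarith [sq_nonneg ‖p - v‖]

/-- The projection moves a point in a direction that makes an angle with `c` bounded away from a right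
angle. With `p` the projection and `e` the unit vector along `p - v`, the point `p + c - s • e` is
still feasible, because `c` has margin one and `s • e` costs at most one; the variational inequality
at that point is the claim. -/
theorem mul_norm_maxMargin_sub_le {s : ℝ} (hs : 0 ≤ s) (hsx : ∀ j, s * ‖y j • x j‖ ≤ 1)
    (v : Vec d) {c : Vec d} (hc : c ∈ feasibleSet x y) :
    s * ‖maxMargin x y v - v‖ ≤ inner ℝ (maxMargin x y v - v) c := by
  have hvi := fun u hu => inner_maxMargin_sub_nonneg (u := u) ⟨c, hc⟩ v hu
  have hp := (isMaxMarginSolution_maxMargin x y ⟨c, hc⟩ v).1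
  set p := maxMargin x y v
  rcases eq_or_ne (p - v) 0 with h0 | h0
  · simp [h0]
  have hn : 0 < ‖p - v‖ := norm_pos_iff.2 h0
  have hmem : p + (c - (s / ‖p - v‖) • (p - v)) ∈ feasibleSet x y := by
    intro j
    have h1 := hp j
    have h2 := hc j
    have h3 : s / ‖p - v‖ * inner ℝ (y j • x j) (p - v) ≤ 1 := by
      calc s / ‖p - v‖ * inner ℝ (y j • x j) (p - v)
          ≤ s / ‖p - v‖ * (‖y j • x j‖ * ‖p - v‖) :=
            mul_le_mul_of_nonneg_left (real_inner_le_norm _ _) (by positivity)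
        _ = s * ‖y j • x j‖ := by field_simp
        _ ≤ 1 := hsx j
    rw [real_inner_smul_left] at h3
    rw [inner_add_right, inner_sub_right, real_inner_smul_right (x j)]
    nlinarith
  have := hvi _ hmem
  rw [add_sub_cancel_left, inner_sub_right, real_inner_smul_right,
    real_inner_self_eq_norm_sq] at this
  have e : s / ‖p - v‖ * ‖p - v‖ ^ 2 = s * ‖p - v‖ := by field_simp
  linarith

end LocalSolutions

/-! ### The global models -/

section Aggregation

variable {M N d : ℕ}

/-- One local step from `a` compared with `L` times one projection step from `v`: the distance of the
starting points `a` and `L • v` is not enlarged, and `O(log L)` is added. -/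
theorem GeneralPosition.exists_localUpdate_comparison {x : Fin N → Vec d} {y : Fin N → ℝ}
    (hz : GeneralPosition fun j => y j • x j) (hne : (feasibleSet x y).Nonempty) (R : ℝ) :
    ∃ C : ℝ, ∀ᶠ L : ℝ in atTop, ∀ v a : Vec d, ‖maxMargin x y v - v‖ ≤ R →
      ‖localUpdate x y (Real.exp (-L)) a - L • maxMargin x y v‖ ≤
        ‖a - L • v‖ + C * Real.log L := by
  obtain ⟨C, hC⟩ := hz.exists_comparison_const R
  refine ⟨C, ?_⟩
  filter_upwards [hC] with L hL v a hR
  have hlam := Real.exp_pos (-L)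
  have h1 := norm_localUpdate_sub_le (x := x) (y := y) hlam a (L • v)
  have h2 := hL v (maxMargin x y v) (localUpdate x y (Real.exp (-L)) (L • v)) hR
    (fun j => by
      rw [real_inner_smul_left]
      exact (isMaxMarginSolution_maxMargin x y hne v).1 j)
    (fun u hu => inner_maxMargin_sub_nonneg hne v fun j => by
      have := hu j
      rwa [real_inner_smul_left] at this)
    (fun h => by
      have h3 := localUpdate_stationary x y hlam (L • v) h
      have h4 : ∀ j, Real.exp (-(inner ℝ (y j • x j)
          (localUpdate x y (Real.exp (-L)) (L • v)) - L)) = Real.exp L *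
          Real.exp (-(y j * inner ℝ (x j) (localUpdate x y (Real.exp (-L)) (L • v)))) := by
        intro j
        rw [← Real.exp_add, real_inner_smul_left]
        ring_nf
      simp only [h4, mul_assoc, real_inner_smul_left _ h]
      rw [← Finset.mul_sum, h3, ← mul_assoc, ← Real.exp_add]
      simp)
  exact (norm_sub_le_norm_sub_add_norm_sub _ _ _).trans (add_le_add h1 h2)

theorem alphaSeq_nonneg (k : ℕ) : 0 ≤ alphaSeq k := by
  have h : (1 : ℝ) ≤ (k : ℝ) + 1 := by linarith [(Nat.cast_nonneg k : (0 : ℝ) ≤ k)]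
  rw [alphaSeq, sub_nonneg, div_le_one (by linarith)]
  exact h

theorem alphaSeq_le_one (k : ℕ) : alphaSeq k ≤ 1 := by
  have : (0 : ℝ) ≤ 1 / ((k : ℝ) + 1) := by positivity
  rw [alphaSeq]
  linarith

theorem half_le_alphaSeq {k : ℕ} (hk : 1 ≤ k) : 1 / 2 ≤ alphaSeq k := by
  have h : (1 : ℝ) ≤ k := by exact_mod_cast hk
  have : 1 / ((k : ℝ) + 1) ≤ 1 / 2 := one_div_le_one_div_of_le (by norm_num) (by linarith)
  rw [alphaSeq]
  linarith

theorem modifiedAggregation_zero_succ (α : ℕ → ℝ) (update : Fin M → Vec d → Vec d) (k : ℕ) :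
    modifiedAggregation α update 0 (k + 1) =
      α k • ((1 / (M : ℝ)) • ∑ i, update i (modifiedAggregation α update 0 k)) := by
  simp [modifiedAggregation]

theorem norm_average_le (hM : 0 < M) {f : Fin M → Vec d} {b : ℝ} (hf : ∀ i, ‖f i‖ ≤ b) :
    ‖(1 / (M : ℝ)) • ∑ i, f i‖ ≤ b := by
  have hM' : (0 : ℝ) < M := by exact_mod_cast hM
  have h := norm_sum_le_of_le Finset.univ fun i _ => hf i
  rw [norm_smul, Real.norm_of_nonneg (by positivity), one_div, inv_mul_le_iff₀ hM']
  simpa using h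

/-- The iterates of the projection method stay in the ball around any common feasible point `c` that
has the starting point `0` on its boundary, since the projections do not increase the distance
to `c`. -/
theorem norm_modifiedPPM_sub_le (hM : 0 < M) {X : Fin M → Fin N → Vec d} {Y : Fin M → Fin N → ℝ}
    {c : Vec d} (hc : ∀ i, c ∈ feasibleSet (X i) (Y i)) (k : ℕ) :
    ‖modifiedPPM X Y alphaSeq 0 k - c‖ ≤ ‖c‖ := by
  induction k with
  | zero => simp [modifiedPPM, modifiedAggregation]
  | succ k ih =>
    have hM' : (M : ℝ) ≠ 0 := by exact_mod_cast hM.ne'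
    set v := modifiedPPM X Y alphaSeq 0 k with hv
    have e : modifiedPPM X Y alphaSeq 0 (k + 1) - c = (1 - alphaSeq k) • (-c) +
        alphaSeq k • ((1 / (M : ℝ)) • ∑ i, (maxMargin (X i) (Y i) v - c)) := by
      rw [modifiedPPM, modifiedAggregation_zero_succ, ← modifiedPPM, ← hv,
        Finset.sum_sub_distrib, Finset.sum_const, Finset.card_univ, Fintype.card_fin,
        ← Nat.cast_smul_eq_nsmul ℝ, smul_sub, smul_smul (1 / (M : ℝ)) (M : ℝ),
        one_div_mul_cancel hM']
      module
    have h0 := alphaSeq_nonneg k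
    have h1 := alphaSeq_le_one k
    have h2 := norm_average_le hM fun i => (norm_maxMargin_sub_le v (hc i)).trans ih
    rw [e]
    refine (norm_add_le _ _).trans ?_
    rw [norm_smul, norm_smul, norm_neg, Real.norm_of_nonneg h0,
      Real.norm_of_nonneg (by linarith : (0 : ℝ) ≤ 1 - alphaSeq k)]
    nlinarith

theorem tendsto_log_one_div : Tendsto (fun lam : ℝ => Real.log (1 / lam)) (𝓝[>] 0) atTop := by
  simp only [one_div]
  exact Real.tendsto_log_atTop.comp tendsto_inv_nhdsGT_zero

/-- The residual grows by `O(log log (1 / lam))` per round, since averaging and the weights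
`α^k ≤ 1` do not enlarge it. -/
theorem exists_residual_bound (hM : 0 < M) {X : Fin M → Fin N → Vec d} {Y : Fin M → Fin N → ℝ}
    (hz : ∀ i, GeneralPosition fun j => Y i j • X i j) (hsep : Separable X Y) :
    ∃ C : ℝ, ∀ᶠ lam in 𝓝[>] (0 : ℝ), ∀ k : ℕ,
      ‖modifiedLocalGD X Y alphaSeq 0 lam k -
        Real.log (1 / lam) • modifiedPPM X Y alphaSeq 0 k‖ ≤
          C * (k * Real.log (Real.log (1 / lam))) := by
  obtain ⟨hne, c, hc⟩ := hsep
  rw [Set.mem_iInter] at hc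
  choose C hC using fun i => (hz i).exists_localUpdate_comparison (hne i) ‖c‖
  have hlim := tendsto_log_one_div
  refine ⟨∑ i, |C i|, ?_⟩
  filter_upwards [hlim.eventually (eventually_all.2 hC), hlim.eventually_ge_atTop 1,
    self_mem_nhdsWithin] with lam hlam hL1 hpos k
  have hpos' : 0 < lam := hpos
  have hexp : Real.exp (-Real.log (1 / lam)) = lam := by
    rw [one_div, Real.log_inv, neg_neg, Real.exp_log hpos']
  simp only [hexp] at hlam
  set L := Real.log (1 / lam)
  have hlog : 0 ≤ Real.log L := Real.log_nonneg hL1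
  induction k with
  | zero => simp [modifiedLocalGD, modifiedPPM, modifiedAggregation]
  | succ k ih =>
    set w := modifiedLocalGD X Y alphaSeq 0 lam k with hw
    set v := modifiedPPM X Y alphaSeq 0 k with hv
    have e : modifiedLocalGD X Y alphaSeq 0 lam (k + 1) -
        L • modifiedPPM X Y alphaSeq 0 (k + 1) = alphaSeq k • ((1 / (M : ℝ)) •
          ∑ i, (localUpdate (X i) (Y i) lam w - L • maxMargin (X i) (Y i) v)) := by
      rw [modifiedLocalGD, modifiedPPM, modifiedAggregation_zero_succ,
        modifiedAggregation_zero_succ, ← modifiedLocalGD, ← modifiedPPM, ← hw, ← hv,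
        Finset.sum_sub_distrib, ← Finset.smul_sum]
      module
    have hi : ∀ i, ‖localUpdate (X i) (Y i) lam w - L • maxMargin (X i) (Y i) v‖ ≤
        (∑ i, |C i|) * (k * Real.log L) + (∑ i, |C i|) * Real.log L := by
      intro i
      have hR : ‖maxMargin (X i) (Y i) v - v‖ ≤ ‖c‖ :=
        ((isMaxMarginSolution_maxMargin _ _ (hne i) v).2 (hc i)).trans <| by
          change ‖c - v‖ ≤ ‖c‖
          rw [norm_sub_rev]
          exact norm_modifiedPPM_sub_le hM hc k
      refine (hlam i v w hR).trans (add_le_add ih (mul_le_mul_of_nonneg_right ?_ hlog))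
      exact (le_abs_self _).trans
        (Finset.single_le_sum (f := fun i => |C i|) (fun _ _ => abs_nonneg _)
          (Finset.mem_univ i))
    have havg := norm_average_le hM hi
    rw [e, norm_smul, Real.norm_of_nonneg (alphaSeq_nonneg k)]
    refine (mul_le_of_le_one_left (norm_nonneg _) (alphaSeq_le_one k)).trans (havg.trans ?_)
    push_cast
    exact le_of_eq (by ring)

/-- From round two on, the iterates of the projection method stay away from zero. They remain in the
cone `{v | s * ‖v‖ ≤ ⟪v, c⟫}`, where `c` is a common feasible point, so averaging over the nodes
produces no cancellation, while every projected point has norm at least `s`. -/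
theorem exists_norm_modifiedPPM_lower_bound (hM : 0 < M) (hN : 0 < N)
    {X : Fin M → Fin N → Vec d} {Y : Fin M → Fin N → ℝ} (hsep : Separable X Y) :
    ∃ δ > 0, ∀ k, 2 ≤ k → δ ≤ ‖modifiedPPM X Y alphaSeq 0 k‖ := by
  obtain ⟨hne, c, hc⟩ := hsep
  rw [Set.mem_iInter] at hc
  have hM' : (0 : ℝ) < M := by exact_mod_cast hM
  set Z : ℝ := ∑ i, ∑ j, ‖Y i j • X i j‖ with hZ
  have hZ0 : 0 ≤ Z := by positivity
  -- the width of the cone, chosen so that `s * ‖y • x‖ ≤ 1` for every sample `(x, y)`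
  set s : ℝ := 1 / (Z + 1) with hs
  have hs0 : 0 < s := by positivity
  have hsz : ∀ i j, s * ‖Y i j • X i j‖ ≤ 1 := by
    intro i j
    have h1 : ‖Y i j • X i j‖ ≤ Z :=
      (Finset.single_le_sum (f := fun j => ‖Y i j • X i j‖) (fun _ _ => norm_nonneg _)
        (Finset.mem_univ j)).trans
      (Finset.single_le_sum (f := fun i => ∑ j, ‖Y i j • X i j‖)
        (fun _ _ => Finset.sum_nonneg fun _ _ => norm_nonneg _) (Finset.mem_univ i))
    rw [hs, one_div, inv_mul_le_iff₀ (by linarith)]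
    linarith
  have hloc : ∀ v : Vec d, s * ‖v‖ ≤ inner ℝ v c → ∀ i,
      s * ‖maxMargin (X i) (Y i) v‖ ≤ inner ℝ (maxMargin (X i) (Y i) v) c := by
    intro v hv i
    have h1 := mul_norm_maxMargin_sub_le hs0.le (hsz i) v (hc i)
    have h2 := norm_le_norm_sub_add (maxMargin (X i) (Y i) v) v
    rw [inner_sub_left] at h1
    nlinarith
  have hfar : ∀ v i, s ≤ ‖maxMargin (X i) (Y i) v‖ := by
    intro v i
    have h1 := (isMaxMarginSolution_maxMargin _ _ (hne i) v).1 ⟨0, hN⟩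
    rw [← real_inner_smul_left] at h1
    have h2 := h1.trans (real_inner_le_norm _ _)
    have h3 := hsz i ⟨0, hN⟩
    nlinarith [norm_nonneg (maxMargin (X i) (Y i) v)]
  have hinner : ∀ k, inner ℝ (modifiedPPM X Y alphaSeq 0 (k + 1)) c = alphaSeq k *
      ((1 / (M : ℝ)) * ∑ i, inner ℝ (maxMargin (X i) (Y i) (modifiedPPM X Y alphaSeq 0 k)) c) := by
    intro k
    rw [modifiedPPM, modifiedAggregation_zero_succ, real_inner_smul_left, real_inner_smul_left,
      sum_inner]
  have hcone : ∀ k, s * ‖modifiedPPM X Y alphaSeq 0 k‖ ≤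
      inner ℝ (modifiedPPM X Y alphaSeq 0 k) c := by
    intro k
    induction k with
    | zero => simp [modifiedPPM, modifiedAggregation]
    | succ k ih =>
      rw [hinner, modifiedPPM, modifiedAggregation_zero_succ, ← modifiedPPM, norm_smul,
        Real.norm_of_nonneg (alphaSeq_nonneg k), norm_smul,
        Real.norm_of_nonneg (by positivity : (0 : ℝ) ≤ 1 / (M : ℝ)), mul_left_comm,
        mul_left_comm s]
      refine mul_le_mul_of_nonneg_left (mul_le_mul_of_nonneg_left ?_ (by positivity))
        (alphaSeq_nonneg k)
      calc s * ‖∑ i, maxMargin (X i) (Y i) (modifiedPPM X Y alphaSeq 0 k)‖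
          ≤ s * ∑ i, ‖maxMargin (X i) (Y i) (modifiedPPM X Y alphaSeq 0 k)‖ :=
            mul_le_mul_of_nonneg_left (norm_sum_le _ _) hs0.le
        _ ≤ _ := by
            rw [Finset.mul_sum]
            exact Finset.sum_le_sum fun i _ => hloc _ ih i
  refine ⟨1 / 2 * s ^ 2 / (‖c‖ + 1), by positivity, fun k hk => ?_⟩
  obtain ⟨k, rfl⟩ : ∃ m, k = m + 1 := ⟨k - 1, by omega⟩
  have h1 : s ^ 2 ≤ (1 / (M : ℝ)) *
      ∑ i, inner ℝ (maxMargin (X i) (Y i) (modifiedPPM X Y alphaSeq 0 k)) c := by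
    rw [one_div, le_inv_mul_iff₀ hM']
    have : ∑ _i : Fin M, s ^ 2 ≤
        ∑ i, inner ℝ (maxMargin (X i) (Y i) (modifiedPPM X Y alphaSeq 0 k)) c :=
      Finset.sum_le_sum fun i _ => by
        have h2 := hloc _ (hcone k) i
        have h3 := hfar (modifiedPPM X Y alphaSeq 0 k) i
        nlinarith
    simpa using this
  have h2 := mul_le_mul (half_le_alphaSeq (by omega : 1 ≤ k)) h1 (by positivity)
    (alphaSeq_nonneg k)
  rw [← hinner] at h2
  have h3 := h2.trans (real_inner_le_norm _ _)
  rw [div_le_iff₀ (by positivity)]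
  nlinarith [norm_nonneg (modifiedPPM X Y alphaSeq 0 (k + 1))]

end Aggregation

/-! ### Directions -/

section Direction

variable {d : ℕ}

theorem direction_smul_of_pos {t : ℝ} (ht : 0 < t) (w : Vec d) :
    direction (t • w) = direction w := by
  rw [direction, direction, norm_smul, Real.norm_of_nonneg ht.le, smul_smul, mul_inv,
    mul_right_comm, inv_mul_cancel₀ ht.ne', one_mul]

theorem norm_direction_sub_le (a : Vec d) {b : Vec d} (hb : b ≠ 0) :
    ‖direction a - direction b‖ ≤ 2 * ‖a - b‖ / ‖b‖ := by
  have hb' : 0 < ‖b‖ := norm_pos_iff.2 hb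
  rcases eq_or_ne a 0 with rfl | ha
  · simp only [direction, norm_zero, inv_zero, smul_zero, zero_sub, norm_neg, norm_smul,
      norm_inv, norm_norm]
    rw [inv_mul_cancel₀ hb'.ne', mul_div_cancel_right₀ _ hb'.ne']
    norm_num
  have ha' : 0 < ‖a‖ := norm_pos_iff.2 ha
  have e : direction a - direction b =
      ‖b‖⁻¹ • (((‖b‖ - ‖a‖) * ‖a‖⁻¹) • a + (a - b)) := by
    have : (‖b‖ - ‖a‖) * ‖a‖⁻¹ = ‖b‖ * ‖a‖⁻¹ - 1 := by field_simp
    rw [this, sub_smul, one_smul, sub_add_sub_cancel, smul_sub, smul_smul, ← mul_assoc,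
      inv_mul_cancel₀ hb'.ne', one_mul, direction, direction]
  have h1 : ‖((‖b‖ - ‖a‖) * ‖a‖⁻¹) • a‖ ≤ ‖a - b‖ := by
    rw [norm_smul, norm_mul, norm_inv, norm_norm, mul_assoc, inv_mul_cancel₀ ha'.ne', mul_one,
      norm_sub_rev a b]
    exact abs_norm_sub_norm_le b a
  rw [e, norm_smul, norm_inv, norm_norm, inv_mul_eq_div]
  gcongr
  linarith [norm_add_le (((‖b‖ - ‖a‖) * ‖a‖⁻¹) • a) (a - b)]

theorem tendsto_direction_sub {ι : Type*} {l : Filter ι} {u v : ι → Vec d} {δ : ℝ} (hδ : 0 < δ)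
    (hv : ∀ᶠ t in l, δ ≤ ‖v t‖) (huv : Tendsto (fun t => u t - v t) l (𝓝 0)) :
    Tendsto (fun t => direction (u t) - direction (v t)) l (𝓝 0) := by
  have hlim : Tendsto (fun t => 2 * ‖u t - v t‖ / δ) l (𝓝 0) := by
    simpa using (huv.norm.const_mul 2).div_const δ
  refine squeeze_zero_norm' ?_ hlim
  filter_upwards [hv] with t ht
  refine (norm_direction_sub_le _ (norm_pos_iff.1 (hδ.trans_le ht))).trans ?_
  gcongr

end Direction

/-! ### Limits as the regularization vanishes -/

section Limits

variable {d : ℕ} {w : ℝ → ℕ → Vec d} {wbar : ℕ → Vec d} {C : ℝ}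

theorem tendsto_rescaled_sub (hres : ∀ᶠ lam in 𝓝[>] (0 : ℝ), ∀ k : ℕ,
      ‖w lam k - Real.log (1 / lam) • wbar k‖ ≤ C * (k * Real.log (Real.log (1 / lam))))
    {k : ℝ → ℕ} (hk : (fun lam => (k lam : ℝ)) =o[𝓝[>] 0]
      (fun lam => Real.log (1 / lam) / Real.log (Real.log (1 / lam)))) :
    Tendsto (fun lam => (Real.log (1 / lam))⁻¹ • w lam (k lam) - wbar (k lam)) (𝓝[>] 0) (𝓝 0) := by
  have hlim : Tendsto (fun lam : ℝ => C * ((k lam : ℝ) /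
      (Real.log (1 / lam) / Real.log (Real.log (1 / lam))))) (𝓝[>] 0) (𝓝 0) := by
    simpa using hk.tendsto_div_nhds_zero.const_mul C
  refine squeeze_zero_norm' ?_ hlim
  filter_upwards [hres, tendsto_log_one_div.eventually_gt_atTop 0] with lam hlam hL
  have e : (Real.log (1 / lam))⁻¹ • w lam (k lam) - wbar (k lam) =
      (Real.log (1 / lam))⁻¹ • (w lam (k lam) - Real.log (1 / lam) • wbar (k lam)) := by
    rw [smul_sub, smul_smul, inv_mul_cancel₀ hL.ne', one_smul]
  rw [e, norm_smul, norm_inv, Real.norm_of_nonneg hL.le, inv_mul_le_iff₀ hL]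
  refine (hlam (k lam)).trans (le_of_eq ?_)
  rw [div_div_eq_mul_div]
  field_simp

theorem const_isLittleO_log_div_log_log (k : ℕ) : (fun _ : ℝ => (k : ℝ)) =o[𝓝[>] 0]
    (fun lam => Real.log (1 / lam) / Real.log (Real.log (1 / lam))) := by
  have h1 : Tendsto (fun L : ℝ => L / Real.log L) atTop atTop := by
    have h2 : Tendsto (fun L : ℝ => Real.log L / L) atTop (𝓝[>] 0) := by
      refine tendsto_nhdsWithin_iff.2 ⟨Real.isLittleO_log_id_atTop.tendsto_div_nhds_zero, ?_⟩
      filter_upwards [eventually_gt_atTop 1] with L hL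
      exact div_pos (Real.log_pos hL) (by linarith)
    simpa only [Function.comp_def, inv_div] using tendsto_inv_nhdsGT_zero.comp h2
  exact isLittleO_const_left.2 (Or.inr
    (tendsto_norm_atTop_atTop.comp (h1.comp tendsto_log_one_div)))

theorem tendsto_direction_rescaled {δ : ℝ} (hδ : 0 < δ)
    (hlow : ∀ k, 2 ≤ k → δ ≤ ‖wbar k‖) {k : ℝ → ℕ}
    (hk2 : ∀ᶠ lam in 𝓝[>] (0 : ℝ), 2 ≤ k lam)
    (h : Tendsto (fun lam => (Real.log (1 / lam))⁻¹ • w lam (k lam) - wbar (k lam))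
      (𝓝[>] 0) (𝓝 0)) :
    (∀ᶠ lam in 𝓝[>] (0 : ℝ), w lam (k lam) ≠ 0) ∧
      Tendsto (fun lam => direction (w lam (k lam)) - direction (wbar (k lam)))
        (𝓝[>] 0) (𝓝 0) := by
  have hlow' : ∀ᶠ lam in 𝓝[>] (0 : ℝ), δ ≤ ‖wbar (k lam)‖ := hk2.mono fun lam h => hlow _ h
  constructor
  · have hsmall := h.norm.eventually_lt_const (by simpa using hδ)
    filter_upwards [hlow', hsmall] with lam h1 h2 h0
    rw [h0, smul_zero, zero_sub, norm_neg] at h2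
    linarith
  · refine (tendsto_direction_sub hδ hlow' h).congr' ?_
    filter_upwards [tendsto_log_one_div.eventually_gt_atTop 0] with lam hL
    rw [direction_smul_of_pos (inv_pos.2 hL)]

end Limits

end LocalGD

theorem mainTheorem6 {M N d : ℕ} (hM : 0 < M) (hN : 0 < N)
    (μ : Measure (Fin M → Fin N → LocalGD.Vec d)) [IsProbabilityMeasure μ] (hμ : μ ≪ volume) :
    ∀ᵐ X ∂μ, ∀ Y : Fin M → Fin N → ℝ, (∀ i j, Y i j = 1 ∨ Y i j = -1) →
      LocalGD.Separable X Y →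
      ∀ (w : ℝ → ℕ → LocalGD.Vec d) (wbar : ℕ → LocalGD.Vec d),
      (∀ lam, w lam = LocalGD.modifiedLocalGD X Y LocalGD.alphaSeq 0 lam) →
      wbar = LocalGD.modifiedPPM X Y LocalGD.alphaSeq 0 →
      -- residual bound, with a constant that depends neither on the round nor on `lam`
      (∃ C : ℝ, ∀ᶠ lam in 𝓝[>] (0 : ℝ), ∀ k : ℕ,
        ‖w lam k - Real.log (1 / lam) • wbar k‖ ≤ C * (k * Real.log (Real.log (1 / lam)))) ∧
      -- `w_0^k` behaves like `ln (1 / lam) • wbar_0^k`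
      (∀ k : ℕ, Tendsto (fun lam => (Real.log (1 / lam))⁻¹ • w lam k) (𝓝[>] 0) (𝓝 (wbar k))) ∧
      -- the first two global models vanish by construction, the later ones have a direction
      (∀ k : ℕ, 2 ≤ k → wbar k ≠ 0) ∧
      -- convergence in direction at a fixed round
      (∀ k : ℕ, 2 ≤ k → (∀ᶠ lam in 𝓝[>] (0 : ℝ), w lam k ≠ 0) ∧
        Tendsto (fun lam => LocalGD.direction (w lam k)) (𝓝[>] 0)
          (𝓝 (LocalGD.direction (wbar k)))) ∧
      -- convergence in direction at rounds that may grow as `lam` tends to `0`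
      (∀ k : ℝ → ℕ, (∀ᶠ lam in 𝓝[>] (0 : ℝ), 2 ≤ k lam) →
        (fun lam => (k lam : ℝ)) =o[𝓝[>] 0]
          (fun lam => Real.log (1 / lam) / Real.log (Real.log (1 / lam))) →
        (∀ᶠ lam in 𝓝[>] (0 : ℝ), w lam (k lam) ≠ 0) ∧
        Tendsto (fun lam => (Real.log (1 / lam))⁻¹ • w lam (k lam) - wbar (k lam))
          (𝓝[>] 0) (𝓝 0) ∧
        Tendsto (fun lam => LocalGD.direction (w lam (k lam)) - LocalGD.direction (wbar (k lam)))
          (𝓝[>] 0) (𝓝 0)) := by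
  filter_upwards [hμ.ae_le (LocalGD.ae_generalPosition M N d)] with X hX Y hY hsep w wbar hw hwbar
  obtain ⟨C, hC⟩ := LocalGD.exists_residual_bound hM (hX Y hY) hsep
  obtain ⟨δ, hδ, hlow⟩ := LocalGD.exists_norm_modifiedPPM_lower_bound hM hN hsep
  simp only [← hw, ← hwbar] at hC hlow
  refine ⟨⟨C, hC⟩, fun k => ?_, fun k hk => ?_, fun k hk => ?_, fun k hk2 hk => ?_⟩
  · exact tendsto_sub_nhds_zero_iff.1 <|
      LocalGD.tendsto_rescaled_sub hC (LocalGD.const_isLittleO_log_div_log_log k)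
  · exact norm_pos_iff.1 (hδ.trans_le (hlow k hk))
  · obtain ⟨h1, h2⟩ := LocalGD.tendsto_direction_rescaled hδ hlow (k := fun _ => k)
      (Eventually.of_forall fun _ => hk)
      (LocalGD.tendsto_rescaled_sub hC (LocalGD.const_isLittleO_log_div_log_log k))
    exact ⟨h1, tendsto_sub_nhds_zero_iff.1 h2⟩
  · have h := LocalGD.tendsto_rescaled_sub hC hk
    obtain ⟨h1, h2⟩ := LocalGD.tendsto_direction_rescaled hδ hlow hk2 h
    exact ⟨h1, h, h2⟩
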